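/- For an integer $t\ge 0$ and complex $q$ with $|q|<1$ let $$U_t(2,q):=\sum_{1\le n_1<n_2<\cdots<n_t}\ \prod_{k=1}^{t}\frac{q^{n_k}}{1+2q^{n_k}+q^{2n_k}},\qquad U_0(2,q):=1.$$ For a congruence subgroup $\Gamma\subseteq \mathrm{SL}_2(\mathbb Z)$ and $k\in\mathbb Z$, a quasimodular form of weight $k$ on $\Gamma$ is a function $f$ on the upper half plane $\mathbb H$ for which there are an integer $p\ge 0$ and holomorphic functions $f_0,\dots,f_p$ on $\mathbb H$ such that $$(c\tau+d)^{-k}f\!\left(\frac{a\tau+b}{c\tau+d}\right)=\sum_{j=0}^{p}f_j(\tau)\left(\frac{c}{c\tau+d}\right)^{j}\qquad\text{for all }\begin{pmatrix}a&b\\c&d\end{pmatrix}\in\Gamma,\ \tau\in\mathbb H$$ (so that $f=f_0$), and such that each $f_j$ is holomorphic at the cusps: for every $\begin{pmatrix}a&b\\c&d\end{pmatrix}\in\mathrm{SL}_2(\mathbb Z)$ the function $(c\tau+d)^{-(k-2j)}f_j\!\left(\frac{a\tau+b}{c\tau+d}\right)$ is bounded as $\operatorname{Im}\tau\to\infty$.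 Let $\widetilde M_{\le w}(\Gamma)$ (quasimodular forms of mixed weight at most $w$) be the space of all sums of quasimodular forms on $\Gamma$ of weights $0,1,\dots,w$. Then for every integer $t\ge 0$, no denominator in the series above vanishes and the series converges absolutely for $|q|<1$, and the function $\tau\mapsto U_t(2,e^{2\pi i\tau})$ on $\mathbb H$ belongs to $\widetilde M_{\le 2t}(\Gamma_0(2))$. -/

import Mathlib

open scoped ModularForm MatrixGroups CongruenceSubgroup Manifold

noncomputable section

/-- The summand `∏ q ^ n / (1 + a q ^ n + q ^ (2 n))` of `U_t(a, q)` attached to the set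
`{n₁ < n₂ < ⋯ < n_t}` of positive integers. -/
def macMahonTerm (a q : ℂ) (s : Finset ℕ+) : ℂ :=
  ∏ n ∈ s, q ^ (n : ℕ) / (1 + a * q ^ (n : ℕ) + q ^ (2 * (n : ℕ)))

/-- `U_t(a, q)`: the sum over all `1 ≤ n₁ < n₂ < ⋯ < n_t`, that is, over all sets of exactly `t`
positive integers. For `t = 0` only the empty set occurs, and `U_0(a, q) = 1`. -/
def macMahonU (t : ℕ) (a q : ℂ) : ℂ :=
  ∑' s : {s : Finset ℕ+ // s.card = t}, macMahonTerm a q s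

/-- `f` is a quasimodular form of weight `k` and depth at most `p` on the congruence subgroup `Γ`
with component functions `F 0, …, F p`: these are holomorphic on the upper half plane,
`(c τ + d) ^ (-k) * f (γ τ) = ∑ j ≤ p, F j τ * (c / (c τ + d)) ^ j` for every
`γ = (a, b; c, d)` in `Γ`, and each `F j` (of weight `k - 2 j`) is holomorphic at every cusp.
Taking `γ = 1` gives `f = F 0`. -/
structure HasQuasimodularComponents (Γ : Subgroup SL(2, ℤ)) (k : ℤ) (f : UpperHalfPlane → ℂ)
    (p : ℕ) (F : ℕ → UpperHalfPlane → ℂ) : Prop where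
  holo : ∀ j ≤ p, MDiff (F j)
  transform : ∀ γ ∈ Γ, ∀ τ : UpperHalfPlane,
    (f ∣[k] γ) τ = ∑ j ∈ Finset.range (p + 1),
      F j τ * (((γ 1 0 : ℤ) : ℂ) / (((γ 1 0 : ℤ) : ℂ) * (τ : ℂ) + ((γ 1 1 : ℤ) : ℂ))) ^ j
  bdd_at_cusps : ∀ j ≤ p, ∀ γ : SL(2, ℤ),
    UpperHalfPlane.IsBoundedAtImInfty (F j ∣[k - 2 * (j : ℤ)] γ)

lemma HasQuasimodularComponents.extend {Γ : Subgroup SL(2, ℤ)} {k : ℤ} {f : UpperHalfPlane → ℂ}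
    {p : ℕ} {F : ℕ → UpperHalfPlane → ℂ} (h : HasQuasimodularComponents Γ k f p F) {p' : ℕ}
    (hp : p ≤ p') :
    HasQuasimodularComponents Γ k f p' (fun j ↦ if j ≤ p then F j else 0) where
  holo j _ := by
    split_ifs with hj
    · exact h.holo j hj
    · exact mdifferentiable_const
  transform γ hγ τ := by
    rw [h.transform γ hγ τ]
    refine Finset.sum_subset_zero_on_sdiff (by simpa using hp) ?_ ?_
    · intro j hj
      have : ¬ j ≤ p := by
        simp only [Finset.mem_sdiff, Finset.mem_range] at hj
        omega
      simp [this]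
    · intro j hj
      have : j ≤ p := by
        simp only [Finset.mem_range] at hj
        omega
      simp [this]
  bdd_at_cusps j _ γ := by
    split_ifs with hj
    · exact h.bdd_at_cusps j hj γ
    · rw [SlashAction.zero_slash]
      exact Filter.const_boundedAtFilter _ 0

lemma HasQuasimodularComponents.add {Γ : Subgroup SL(2, ℤ)} {k : ℤ} {f g : UpperHalfPlane → ℂ}
    {p : ℕ} {F G : ℕ → UpperHalfPlane → ℂ} (hf : HasQuasimodularComponents Γ k f p F)
    (hg : HasQuasimodularComponents Γ k g p G) :
    HasQuasimodularComponents Γ k (f + g) p (F + G) where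
  holo j hj := (hf.holo j hj).add (hg.holo j hj)
  transform γ hγ τ := by
    rw [SlashAction.add_slash, Pi.add_apply, hf.transform γ hγ τ, hg.transform γ hγ τ,
      ← Finset.sum_add_distrib]
    exact Finset.sum_congr rfl fun j _ ↦ by simp [add_mul]
  bdd_at_cusps j hj γ := by
    rw [Pi.add_apply, SlashAction.add_slash]
    exact (hf.bdd_at_cusps j hj γ).add (hg.bdd_at_cusps j hj γ)

lemma HasQuasimodularComponents.smul {Γ : Subgroup SL(2, ℤ)} {k : ℤ} {f : UpperHalfPlane → ℂ}
    {p : ℕ} {F : ℕ → UpperHalfPlane → ℂ} (hf : HasQuasimodularComponents Γ k f p F) (c : ℂ) :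
    HasQuasimodularComponents Γ k (c • f) p (c • F) where
  holo j hj := (hf.holo j hj).const_smul c
  transform γ hγ τ := by
    rw [ModularForm.SL_smul_slash, Pi.smul_apply, hf.transform γ hγ τ, Finset.smul_sum]
    exact Finset.sum_congr rfl fun j _ ↦ by simp [mul_assoc]
  bdd_at_cusps j hj γ := by
    rw [Pi.smul_apply, ModularForm.SL_smul_slash]
    exact (hf.bdd_at_cusps j hj γ).const_smul_left c

/-- The space of quasimodular forms of (pure) weight `k` on the congruence subgroup `Γ`, of
arbitrary depth. -/
def quasimodularForms (Γ : Subgroup SL(2, ℤ)) (k : ℤ) : Submodule ℂ (UpperHalfPlane → ℂ) where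
  carrier := {f | ∃ (p : ℕ) (F : ℕ → UpperHalfPlane → ℂ), HasQuasimodularComponents Γ k f p F}
  zero_mem' := ⟨0, 0, {
    holo := fun _ _ ↦ mdifferentiable_const
    transform := fun γ _ τ ↦ by simp [SlashAction.zero_slash]
    bdd_at_cusps := fun j _ γ ↦ by
      rw [Pi.zero_apply, SlashAction.zero_slash]
      exact Filter.const_boundedAtFilter _ 0 }⟩
  add_mem' := by
    rintro f g ⟨p, F, hF⟩ ⟨p', G, hG⟩
    exact ⟨_, _, (hF.extend (le_max_left p p')).add (hG.extend (le_max_right p p'))⟩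
  smul_mem' := by
    rintro c f ⟨p, F, hF⟩
    exact ⟨p, _, hF.smul c⟩

/-- The space of quasimodular forms of mixed weight at most `w` on `Γ`: the sums of quasimodular
forms of pure weights `0, 1, …, w`. -/
def quasimodularFormsMixed (Γ : Subgroup SL(2, ℤ)) (w : ℕ) : Submodule ℂ (UpperHalfPlane → ℂ) :=
  ⨆ k ∈ Finset.range (w + 1), quasimodularForms Γ (k : ℤ)

end

/-! Put `x_n = q^n / (1 + q^n)^2`. Then `U_t(2, q)` is the `t`-th elementary symmetric function of
the `x_n`, and Newton's identities (`mul_tsum_prod_eq_sum`) write `t U_t` through products of `U_i`,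
`i < t`, with power sums of exponent `t - i`. Since mixed weights add under multiplication, strong
induction reduces the claim to power sums.

Expanding `x_n ^ (l + 1)` as a binomial series in `-q^n` gives coefficients that are odd polynomials
in the summation index (`choose_eq_sum_odd_pow`). Hence the power sum is a combination of the series
`∑ (-1)^m m^(2j+1) q^(nm)` with `j ≤ l`. Separating even `m` expresses each by an ordinary Lambert
series at `q` and at `q^2` (`alternatingLambert_eq`). The ordinary series is, up to an affine
change, the Eisenstein series of weight `2j + 2`; the argument `q^2` forces level `Γ₀(2)`, and the
constant term forces mixed weight. -/

noncomputable section

open UpperHalfPlane ModularForm EisensteinSeries Matrix.SpecialLinearGroup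

/-! ### Products of quasimodular forms and the weight filtration. -/

section Algebra

variable {Γ : Subgroup SL(2, ℤ)}

/-- Both transformation laws are polynomials in `c / (cτ + d)`; the components of the product are
the coefficients of the product polynomial. -/
lemma HasQuasimodularComponents.mul {k l : ℤ} {f g : ℍ → ℂ} {p r : ℕ} {F G : ℕ → ℍ → ℂ}
    (hf : HasQuasimodularComponents Γ k f p F) (hg : HasQuasimodularComponents Γ l g r G) :
    HasQuasimodularComponents Γ (k + l) (f * g) (p + r) (fun n ↦
      ∑ x ∈ (Finset.range (p + 1) ×ˢ Finset.range (r + 1)) with x.1 + x.2 = n,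
        F x.1 * G x.2) where
  holo n _ := by
    refine MDifferentiable.sum fun x hx ↦ ?_
    simp only [Finset.mem_filter, Finset.mem_product, Finset.mem_range] at hx
    exact (hf.holo _ (by omega)).mul (hg.holo _ (by omega))
  transform γ hγ τ := by
    rw [mul_slash_SL2, Pi.mul_apply, hf.transform γ hγ τ, hg.transform γ hγ τ,
      Finset.sum_mul_sum, ← Finset.sum_product',
      ← Finset.sum_fiberwise_of_maps_to (g := fun x : ℕ × ℕ ↦ x.1 + x.2)
        (t := Finset.range (p + r + 1))]
    · refine Finset.sum_congr rfl fun n _ ↦ ?_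
      rw [Finset.sum_apply, Finset.sum_mul]
      refine Finset.sum_congr rfl fun x hx ↦ ?_
      rw [← (Finset.mem_filter.mp hx).2, Pi.mul_apply, pow_add]
      ring
    · intro x hx
      simp only [Finset.mem_product, Finset.mem_range] at hx ⊢
      omega
  bdd_at_cusps n _ γ := by
    rw [SlashAction.sum_slash]
    refine Finset.sum_induction _ IsBoundedAtImInfty (fun _ _ ↦ Filter.BoundedAtFilter.add)
      (Filter.const_boundedAtFilter _ 0) fun x hx ↦ ?_
    simp only [Finset.mem_filter, Finset.mem_product, Finset.mem_range] at hx
    have h : k + l - 2 * (n : ℤ) = (k - 2 * (x.1 : ℤ)) + (l - 2 * (x.2 : ℤ)) := by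
      have := hx.2
      push_cast [← this]
      ring
    rw [h, mul_slash_SL2]
    exact (hf.bdd_at_cusps _ (by omega) γ).mul (hg.bdd_at_cusps _ (by omega) γ)

lemma quasimodularForms_mul_mem {k l : ℤ} {f g : ℍ → ℂ} (hf : f ∈ quasimodularForms Γ k)
    (hg : g ∈ quasimodularForms Γ l) : f * g ∈ quasimodularForms Γ (k + l) := by
  obtain ⟨p, F, hF⟩ := hf
  obtain ⟨r, G, hG⟩ := hg
  exact ⟨_, _, hF.mul hG⟩

lemma quasimodularForms_antitone {Γ' : Subgroup SL(2, ℤ)} (h : Γ' ≤ Γ) (k : ℤ) :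
    quasimodularForms Γ k ≤ quasimodularForms Γ' k := by
  rintro f ⟨p, F, hF⟩
  exact ⟨p, F, hF.holo, fun γ hγ ↦ hF.transform γ (h hγ), hF.bdd_at_cusps⟩

lemma one_mem_quasimodularForms : (1 : ℍ → ℂ) ∈ quasimodularForms Γ 0 := by
  have h (γ : SL(2, ℤ)) : (1 : ℍ → ℂ) ∣[(0 : ℤ)] γ = 1 := is_invariant_const γ 1
  refine ⟨0, fun _ ↦ 1, fun _ _ ↦ mdifferentiable_const, fun γ _ τ ↦ by simp [h], ?_⟩
  intro j hj γ
  obtain rfl : j = 0 := by omega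
  simp only [Nat.cast_zero, mul_zero, sub_zero, h]
  exact Filter.const_boundedAtFilter _ 1

lemma quasimodularForms_le_mixed {k w : ℕ} (h : k ≤ w) :
    quasimodularForms Γ (k : ℤ) ≤ quasimodularFormsMixed Γ w :=
  le_iSup₂_of_le k (by simpa using Nat.lt_succ_of_le h) le_rfl

lemma quasimodularFormsMixed_mono {v w : ℕ} (h : v ≤ w) :
    quasimodularFormsMixed Γ v ≤ quasimodularFormsMixed Γ w :=
  iSup₂_le fun k hk ↦ quasimodularForms_le_mixed (by simp at hk; omega)

lemma one_mem_quasimodularFormsMixed (w : ℕ) : (1 : ℍ → ℂ) ∈ quasimodularFormsMixed Γ w :=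
  quasimodularForms_le_mixed (Nat.zero_le w) (by simpa using one_mem_quasimodularForms)

lemma quasimodularFormsMixed_mul_le (v w : ℕ) :
    quasimodularFormsMixed Γ v * quasimodularFormsMixed Γ w ≤
      quasimodularFormsMixed Γ (v + w) := by
  simp only [quasimodularFormsMixed, Submodule.iSup_mul, Submodule.mul_iSup]
  refine iSup₂_le fun l hl ↦ iSup₂_le fun k hk ↦ Submodule.mul_le.mpr fun f hf g hg ↦ ?_
  simp only [Finset.mem_range] at hk hl
  exact quasimodularForms_le_mixed (k := k + l) (by omega)
    (by simpa [add_comm] using quasimodularForms_mul_mem hf hg)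

lemma quasimodularFormsMixed_mul_mem {v w : ℕ} {f g : ℍ → ℂ}
    (hf : f ∈ quasimodularFormsMixed Γ v) (hg : g ∈ quasimodularFormsMixed Γ w) :
    f * g ∈ quasimodularFormsMixed Γ (v + w) :=
  quasimodularFormsMixed_mul_le v w (Submodule.mul_mem_mul hf hg)

end Algebra

/-! ### The substitution `τ ↦ N τ`, from level one to `Γ₀(N)`. -/

section Scale

variable (N : ℕ) [NeZero N]

/-- The matrix `(N, 0; 0, 1)`, acting on the upper half plane by `τ ↦ N τ`. -/
def scaleMatrix : GL (Fin 2) ℝ :=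
  Matrix.GeneralLinearGroup.mkOfDetNeZero !![(N : ℝ), 0; 0, 1] (by simp [NeZero.ne N])

lemma coe_scaleMatrix : (scaleMatrix N : Matrix (Fin 2) (Fin 2) ℝ) = !![(N : ℝ), 0; 0, 1] := rfl

lemma det_scaleMatrix : (scaleMatrix N).det.val = N := by
  simp [coe_scaleMatrix]

lemma det_scaleMatrix_pos : 0 < (scaleMatrix N).det.val := by
  rw [det_scaleMatrix]
  exact_mod_cast NeZero.pos N

lemma coe_scaleMatrix_smul (τ : ℍ) : ((scaleMatrix N • τ : ℍ) : ℂ) = N * τ := by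
  rw [coe_smul_of_det_pos (det_scaleMatrix_pos N)]
  simp [num, denom, coe_scaleMatrix]

lemma slash_scaleMatrix (k : ℤ) (f : ℍ → ℂ) :
    f ∣[k] scaleMatrix N = ((N : ℂ) ^ (k - 1)) • fun τ ↦ f (scaleMatrix N • τ) := by
  ext τ
  rw [slash_apply, det_scaleMatrix, σ, if_pos (det_scaleMatrix_pos N)]
  simp [denom, coe_scaleMatrix, mul_comm]

/-- Conjugating `Γ₀(N)` by `(N, 0; 0, 1)` lands in `SL(2, ℤ)`. -/
lemma exists_scaleMatrix_mul_eq {γ : SL(2, ℤ)} (hγ : γ ∈ CongruenceSubgroup.Gamma0 N) :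
    ∃ δ : SL(2, ℤ), γ 1 0 = N * δ 1 0 ∧ γ 1 1 = δ 1 1 ∧
      scaleMatrix N * mapGL ℝ γ = mapGL ℝ δ * scaleMatrix N := by
  rw [CongruenceSubgroup.Gamma0_mem, ZMod.intCast_zmod_eq_zero_iff_dvd] at hγ
  obtain ⟨c, hc⟩ := hγ
  have hdet := γ.det_coe
  rw [Matrix.det_fin_two] at hdet
  obtain ⟨δ, h₀₀, h₀₁, h₁₀, h₁₁⟩ : ∃ δ : SL(2, ℤ),
      δ 0 0 = γ 0 0 ∧ δ 0 1 = N * γ 0 1 ∧ δ 1 0 = c ∧ δ 1 1 = γ 1 1 := by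
    refine ⟨⟨!![γ 0 0, N * γ 0 1; c, γ 1 1], ?_⟩, rfl, rfl, rfl, rfl⟩
    rw [hc] at hdet
    rw [Matrix.det_fin_two_of]
    linear_combination hdet
  refine ⟨δ, by rw [hc, h₁₀], h₁₁.symm, ?_⟩
  ext i j
  simp only [Units.val_mul, mapGL_coe_matrix, map_apply_coe, coe_scaleMatrix, Matrix.mul_apply,
    Fin.sum_univ_two]
  fin_cases i <;> fin_cases j <;> simp [h₀₀, h₀₁, h₁₀, h₁₁, hc, mul_comm]

/-- The cusps of `SL(2, ℤ)` are the points of `ℙ¹(ℚ)`, which every rational matrix preserves. -/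
lemma isCusp_scaleMatrix_smul {c : OnePoint ℝ} (hc : IsCusp c 𝒮ℒ) :
    IsCusp (scaleMatrix N • c) 𝒮ℒ := by
  rw [isCusp_SL2Z_iff] at hc ⊢
  obtain ⟨x, rfl⟩ := hc
  let g : GL (Fin 2) ℚ :=
    Matrix.GeneralLinearGroup.mkOfDetNeZero !![(N : ℚ), 0; 0, 1] (by simp [NeZero.ne N])
  have hg : g.map (Rat.castHom ℝ) = scaleMatrix N := by
    ext i j
    fin_cases i <;> fin_cases j <;>
      simp [g, coe_scaleMatrix, Matrix.GeneralLinearGroup.mkOfDetNeZero]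
  refine ⟨g • x, ?_⟩
  rw [← Rat.coe_castHom, OnePoint.map_smul, hg]

lemma isBoundedAtImInfty_scale_slash {k : ℤ} {f : ℍ → ℂ}
    (hf : ∀ γ : SL(2, ℤ), IsBoundedAtImInfty (f ∣[k] γ)) (γ : SL(2, ℤ)) :
    IsBoundedAtImInfty ((fun τ ↦ f (scaleMatrix N • τ)) ∣[k] γ) := by
  have hγ : IsCusp (mapGL ℝ γ • OnePoint.infty) 𝒮ℒ := isCusp_SL2Z_iff'.mpr ⟨γ, rfl⟩
  have h : IsBoundedAtImInfty ((f ∣[k] scaleMatrix N) ∣[k] γ) := by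
    -- Boundedness at `∞` after slashing is boundedness of `f` itself at the image cusp, which is
    -- again rational.
    rw [← OnePoint.isBoundedAt_infty_iff, SL_slash, ← OnePoint.IsBoundedAt.smul_iff,
      ← OnePoint.IsBoundedAt.smul_iff]
    exact (OnePoint.isBoundedAt_iff_forall_SL2Z (isCusp_scaleMatrix_smul N hγ)).mpr
      fun δ _ ↦ hf δ
  rw [slash_scaleMatrix, SL_smul_slash] at h
  have hN : (N : ℂ) ^ (k - 1) ≠ 0 := zpow_ne_zero _ (by exact_mod_cast NeZero.ne N)
  have h' := h.const_smul_left (((N : ℂ) ^ (k - 1))⁻¹)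
  rwa [smul_smul, inv_mul_cancel₀ hN, one_smul] at h'

lemma scale_mem_quasimodularForms {k : ℤ} {f : ℍ → ℂ} (hf : f ∈ quasimodularForms ⊤ k) :
    (fun τ ↦ f (scaleMatrix N • τ)) ∈ quasimodularForms (CongruenceSubgroup.Gamma0 N) k := by
  obtain ⟨p, F, hF⟩ := hf
  have hN : (N : ℂ) ≠ 0 := by exact_mod_cast NeZero.ne N
  -- The lower left entry of the conjugate `δ` is `c / N`, so each factor `c / (cτ + d)` costs one
  -- `N⁻¹`.
  refine ⟨p, fun j ↦ ((N : ℂ) ^ j)⁻¹ • fun τ ↦ F j (scaleMatrix N • τ), ?_, ?_, ?_⟩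
  · exact fun j hj ↦ MDifferentiable.const_smul _
      ((hF.holo j hj).comp (mdifferentiable_smul (det_scaleMatrix_pos N)))
  · intro γ hγ τ
    obtain ⟨δ, hδ₀, hδ₁, hδ⟩ := exists_scaleMatrix_mul_eq N hγ
    have h := hF.transform δ (Subgroup.mem_top δ) (scaleMatrix N • τ)
    have hd : ((γ 1 0 : ℤ) : ℂ) * τ + ((γ 1 1 : ℤ) : ℂ) =
        ((δ 1 0 : ℤ) : ℂ) * (scaleMatrix N • τ : ℍ) + ((δ 1 1 : ℤ) : ℂ) := by
      rw [coe_scaleMatrix_smul, hδ₀, hδ₁]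
      push_cast
      ring
    have hs : scaleMatrix N • γ • τ = δ • scaleMatrix N • τ := by
      have := congrArg (· • τ) hδ
      simp only [mul_smul] at this
      exact this
    rw [SL_slash_apply, ModularGroup.denom_apply] at h ⊢
    rw [hs, hd, h]
    refine Finset.sum_congr rfl fun j _ ↦ ?_
    rw [hδ₀]
    push_cast
    simp only [Pi.smul_apply, smul_eq_mul, div_pow, mul_pow]
    field_simp
  · intro j hj γ
    rw [SL_smul_slash]
    exact (isBoundedAtImInfty_scale_slash N (hF.bdd_at_cusps j hj) γ).const_smul_left _

end Scale

/-! ### Eisenstein series as quasimodular forms of level one. -/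

section Eisenstein

lemma ModularForm.mem_quasimodularForms {k : ℤ} (f : ModularForm 𝒮ℒ k) :
    (f : ℍ → ℂ) ∈ quasimodularForms ⊤ k := by
  refine ⟨0, fun _ ↦ f, fun _ _ ↦ f.holo', fun γ _ τ ↦ ?_, ?_⟩
  · have : (f : ℍ → ℂ) ∣[k] γ = f := f.slash_action_eq' _ ⟨γ, rfl⟩
    simp [this]
  · intro j hj γ
    obtain rfl : j = 0 := by omega
    simpa using ModularFormClass.bdd_at_infty_slash f γ

lemma norm_div_mul_add_le_one (c d : ℤ) {τ : ℍ} (hτ : 1 ≤ τ.im) :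
    ‖(c : ℂ) / (c * τ + d)‖ ≤ 1 := by
  rw [norm_div]
  refine div_le_one_of_le₀ ?_ (norm_nonneg _)
  calc ‖(c : ℂ)‖ = |(c : ℝ)| * 1 := by simp
    _ ≤ |(c : ℝ)| * |τ.im| := by gcongr; exact hτ.trans (le_abs_self _)
    _ = |((c : ℂ) * τ + d).im| := by simp [abs_mul]
    _ ≤ _ := Complex.abs_im_le_norm _

lemma E2_mem_quasimodularForms : E2 ∈ quasimodularForms ⊤ 2 := by
  let c : ℂ := -(1 / (2 * riemannZeta 2)) * (2 * Real.pi * Complex.I)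
  have hE (γ : SL(2, ℤ)) (τ : ℍ) : (E2 ∣[(2 : ℤ)] γ) τ = E2 τ + c *
      (((γ 1 0 : ℤ) : ℂ) / (((γ 1 0 : ℤ) : ℂ) * (τ : ℂ) + ((γ 1 1 : ℤ) : ℂ))) := by
    rw [E2_slash_action]
    simp only [Pi.sub_apply, Pi.smul_apply, D2, smul_eq_mul, ModularGroup.denom_apply, c]
    ring
  have hc (γ : SL(2, ℤ)) : (Function.const ℍ c) ∣[(0 : ℤ)] γ = Function.const ℍ c :=
    is_invariant_const γ c
  -- The anomaly of `E2` is a constant multiple of `c / (cτ + d)`: depth one, with a constant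
  -- component of weight `0`.
  refine ⟨1, fun j ↦ if j = 0 then E2 else Function.const ℍ c, fun j _ ↦ ?_, fun γ _ τ ↦ ?_,
    fun j hj γ ↦ ?_⟩
  · split_ifs
    exacts [E2_mdifferentiable, mdifferentiable_const]
  · rw [hE]
    simp [Finset.sum_range_succ]
  · obtain rfl | rfl : j = 0 ∨ j = 1 := by omega
    · simp only [if_true, Nat.cast_zero, mul_zero, sub_zero]
      rw [show E2 ∣[(2 : ℤ)] γ = E2 + fun τ : ℍ ↦ c * (((γ 1 0 : ℤ) : ℂ) /
        (((γ 1 0 : ℤ) : ℂ) * (τ : ℂ) + ((γ 1 1 : ℤ) : ℂ))) from funext fun τ ↦ hE γ τ]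
      refine isBoundedAtImInfty_E2.add (isBoundedAtImInfty_iff.mpr ⟨‖c‖ * 1, 1, fun τ hτ ↦ ?_⟩)
      rw [norm_mul]
      gcongr
      exact norm_div_mul_add_le_one _ _ hτ
    · simp only [one_ne_zero, if_false, Nat.cast_one, mul_one, sub_self, hc]
      exact Filter.const_boundedAtFilter _ c

end Eisenstein
end

noncomputable section

open Filter Topology

/-! ### Newton's identities for infinite families. -/

section Newton

variable {ι : Type*} {f : ι → ℂ}

/-- As `S` exhausts `ι`, its `k`-element subsets exhaust all `k`-element subsets, so this passes
finite identities to the limit. -/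
lemma tendsto_esymm_tsum_prod {k : ℕ} (hf : Summable fun i ↦ ‖f i‖) :
    Tendsto (fun S : Finset ι ↦ (S.val.map f).esymm k) atTop
      (𝓝 (∑' s : {s : Finset ι // s.card = k}, ∏ i ∈ s.1, f i)) := by
  classical
  have h : Summable fun s : {s : Finset ι // s.card = k} ↦ ∏ i ∈ s.1, f i :=
    (summable_finsetProd_of_summable_norm hf).subtype {s | s.card = k}
  have ht : Tendsto (fun S : Finset ι ↦ (S.powersetCard k).subtype (fun s ↦ s.card = k))
      atTop atTop := by
    refine tendsto_atTop_finset_of_monotone (fun S T hST s hs ↦ ?_) fun s ↦ ⟨s.1, ?_⟩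
    · simp only [Finset.mem_subtype, Finset.mem_powersetCard] at hs ⊢
      exact ⟨hs.1.trans hST, hs.2⟩
    · simp [s.2]
  refine (h.hasSum.comp ht).congr fun S ↦ ?_
  rw [Finset.esymm_map_val, Function.comp_apply,
    Finset.sum_subtype_of_mem (p := fun s : Finset ι ↦ s.card = k) (fun s ↦ ∏ i ∈ s, f i)]
  exact fun s hs ↦ (Finset.mem_powersetCard.mp hs).2

lemma Finset.mul_esymm_map_eq_sum (S : Finset ι) (k : ℕ) :
    k * (S.val.map f).esymm k = (-1) ^ (k + 1) *
      ∑ a ∈ Finset.HasAntidiagonal.antidiagonal k with a.1 < k,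
        (-1) ^ a.1 * (S.val.map f).esymm a.1 * ∑ i ∈ S, f i ^ a.2 := by
  have h := congrArg (MvPolynomial.aeval fun i : S ↦ f i) (MvPolynomial.mul_esymm_eq_sum S ℂ k)
  have he (n : ℕ) : MvPolynomial.aeval (fun i : S ↦ f i) (MvPolynomial.esymm S ℂ n) =
      (S.val.map f).esymm n := by
    rw [MvPolynomial.aeval_esymm_eq_multiset_esymm]
    congr 1
    exact Multiset.attach_map_val' S.val f
  have hp (n : ℕ) : MvPolynomial.aeval (fun i : S ↦ f i) (MvPolynomial.psum S ℂ n) =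
      ∑ i ∈ S, f i ^ n := by
    simp only [MvPolynomial.psum, map_sum, map_pow, MvPolynomial.aeval_X]
    exact S.sum_coe_sort fun i ↦ f i ^ n
  simpa only [map_mul, map_sum, map_pow, map_neg, map_one, map_natCast, he, hp] using h

lemma summable_norm_pow_succ (hf : Summable fun i ↦ ‖f i‖) (n : ℕ) :
    Summable fun i ↦ f i ^ (n + 1) := by
  refine hf.of_norm_bounded_eventually ?_
  filter_upwards [hf.tendsto_cofinite_zero.eventually_le_const one_pos] with i hi
  rw [norm_pow]
  exact pow_le_of_le_one (norm_nonneg _) hi n.succ_ne_zero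

/-- **Newton's identities** for absolutely summable families. -/
lemma mul_tsum_prod_eq_sum (hf : Summable fun i ↦ ‖f i‖) (k : ℕ) :
    k * ∑' s : {s : Finset ι // s.card = k}, ∏ i ∈ s.1, f i = (-1) ^ (k + 1) *
      ∑ a ∈ Finset.HasAntidiagonal.antidiagonal k with a.1 < k,
        (-1) ^ a.1 * (∑' s : {s : Finset ι // s.card = a.1}, ∏ i ∈ s.1, f i) *
          ∑' i, f i ^ a.2 := by
  refine tendsto_nhds_unique ((tendsto_esymm_tsum_prod hf).const_mul (k : ℂ)) ?_
  simp_rw [Finset.mul_esymm_map_eq_sum]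
  refine Tendsto.const_mul _ (tendsto_finsetSum _ fun a ha ↦ ?_)
  refine ((tendsto_esymm_tsum_prod hf).const_mul _).mul ?_
  simp only [Finset.mem_filter, Finset.HasAntidiagonal.mem_antidiagonal] at ha
  -- Since `a.1 < k`, the divergent zeroth power sum never occurs.
  obtain ⟨n, hn⟩ : ∃ n, a.2 = n + 1 := ⟨a.2 - 1, by omega⟩
  rw [hn]
  exact (summable_norm_pow_succ hf n).hasSum

end Newton

/-! ### Power sums as alternating Lambert series. -/

section Lambert

/-- The binomial equals `m ∏_{i=1}^{l} (m² - i²) / (2l+1)!`. Oddness matters: odd powers of `m` lead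
to Eisenstein series of even weight. -/
lemma choose_eq_sum_odd_pow (l : ℕ) : ∃ c : ℕ → ℂ, ∀ m : ℕ,
    ((m + l).choose (2 * l + 1) : ℂ) = ∑ j ∈ Finset.range (l + 1), c j * (m : ℂ) ^ (2 * j + 1) := by
  suffices ∃ p : Polynomial ℂ, p.natDegree ≤ l ∧ ∀ m : ℕ,
      ((m + l).choose (2 * l + 1) : ℂ) = m * p.eval ((m : ℂ) ^ 2) by
    obtain ⟨p, hp, h⟩ := this
    refine ⟨p.coeff, fun m ↦ ?_⟩
    rw [h, Polynomial.eval_eq_sum_range' (Nat.lt_succ_of_le hp), Finset.mul_sum]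
    exact Finset.sum_congr rfl fun j _ ↦ by ring
  induction l with
  | zero => exact ⟨1, by simp, by simp⟩
  | succ l ih =>
    obtain ⟨p, hp, h⟩ := ih
    refine ⟨Polynomial.C (((2 * l + 2) * (2 * l + 3) : ℂ)⁻¹) *
      (p * (Polynomial.X - Polynomial.C (((l : ℂ) + 1) ^ 2))), ?_, fun m ↦ ?_⟩
    · refine (Polynomial.natDegree_C_mul_le _ _).trans (Polynomial.natDegree_mul_le.trans ?_)
      exact add_le_add hp (Polynomial.natDegree_X_sub_C_le _)
    · have h₁ := Nat.add_one_mul_choose_eq (m + l) (2 * l + 1)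
      have h₂ := Nat.choose_succ_right_eq (m + l + 1) (2 * l + 2)
      have h₂' : ((m + l + 1).choose (2 * l + 3) : ℂ) * (2 * l + 3) =
          (m + l + 1).choose (2 * l + 2) * ((m : ℂ) - l - 1) := by
        -- For `m ≤ l` the natural-number subtraction truncates, but both binomials vanish.
        rcases le_or_gt (2 * l + 2) (m + l + 1) with hle | hlt
        · have := congrArg (Nat.cast : ℕ → ℂ) h₂
          rw [Nat.cast_mul, Nat.cast_mul, Nat.cast_sub hle] at this
          push_cast at this
          linear_combination this
        · simp [Nat.choose_eq_zero_of_lt hlt, Nat.choose_eq_zero_of_lt (hlt.trans (Nat.lt_succ_self _))]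
      have h₁' := congrArg (Nat.cast : ℕ → ℂ) h₁
      push_cast at h₁'
      rw [h m] at h₁'
      have e₁ : (2 * (l : ℂ) + 2) ≠ 0 := by exact_mod_cast (2 * l + 1).succ_ne_zero
      have e₂ : (2 * (l : ℂ) + 3) ≠ 0 := by exact_mod_cast (2 * l + 2).succ_ne_zero
      rw [show m + (l + 1) = m + l + 1 by ring, show 2 * (l + 1) + 1 = 2 * l + 3 by ring]
      simp only [Polynomial.eval_mul, Polynomial.eval_C, Polynomial.eval_sub, Polynomial.eval_X]
      field_simp
      linear_combination (2 * (l : ℂ) + 2) * h₂' - ((m : ℂ) - l - 1) * h₁'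

/-- This is the series of `(1 + z)^(-(2l+2))` shifted by `l + 1`; the terms with `m ≤ l` vanish. -/
lemma hasSum_choose_mul_neg_pow (l : ℕ) {z : ℂ} (hz : ‖z‖ < 1) :
    HasSum (fun m : ℕ ↦ ((m + l).choose (2 * l + 1) : ℂ) * (-z) ^ m)
      ((-1) ^ (l + 1) * (z / (1 + 2 * z + z ^ 2)) ^ (l + 1)) := by
  have h := (hasSum_choose_mul_geometric_of_norm_lt_one (2 * l + 1) (r := -z)
    (by simpa using hz)).mul_left ((-z) ^ (l + 1))
  rw [← hasSum_nat_add_iff' (l + 1), Finset.sum_eq_zero, sub_zero]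
  · convert! h using 1
    · ext m
      rw [show m + (l + 1) + l = m + (2 * l + 1) by ring, pow_add]
      ring
    · rw [show 1 + 2 * z + z ^ 2 = (1 - -z) ^ 2 by ring, show 2 * l + 1 + 1 = 2 * (l + 1) by ring,
        div_pow, ← pow_mul, neg_pow z]
      ring
  · intro m hm
    rw [Finset.mem_range] at hm
    rw [Nat.choose_eq_zero_of_lt (by omega), Nat.cast_zero, zero_mul]

lemma tsum_pnat_choose_mul_neg_pow (l : ℕ) {z : ℂ} (hz : ‖z‖ < 1) :
    ∑' m : ℕ+, ((m + l : ℕ).choose (2 * l + 1) : ℂ) * (-z) ^ (m : ℕ) =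
      (-1) ^ (l + 1) * (z / (1 + 2 * z + z ^ 2)) ^ (l + 1) := by
  have h := hasSum_choose_mul_neg_pow l hz
  rw [← h.tsum_eq, ← tsum_zero_pnat_eq_tsum_nat h.summable, zero_add,
    Nat.choose_eq_zero_of_lt (by omega), Nat.cast_zero, zero_mul, zero_add]

/-- The Lambert series `∑ n, ∑ m, (-1) ^ m * m ^ k * q ^ (n * m)`. -/
def alternatingLambert (k : ℕ) (q : ℂ) : ℂ :=
  ∑' x : ℕ+ × ℕ+, (-1) ^ (x.2 : ℕ) * ((x.2 : ℂ) ^ k * q ^ (x.1 * x.2 : ℕ))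

/-- The Lambert series `∑ n, ∑ m, m ^ k * q ^ (n * m)`. -/
def lambert (k : ℕ) (q : ℂ) : ℂ :=
  ∑' x : ℕ+ × ℕ+, (x.2 : ℂ) ^ k * q ^ (x.1 * x.2 : ℕ)

lemma summable_alternatingLambert (k : ℕ) {q : ℂ} (hq : ‖q‖ < 1) :
    Summable fun x : ℕ+ × ℕ+ ↦ (-1) ^ (x.2 : ℕ) * ((x.2 : ℂ) ^ k * q ^ (x.1 * x.2 : ℕ)) :=
  (summable_prod_mul_pow k hq).norm.of_norm_bounded fun x ↦ by simp

/-- Write `(-1)^m = -1 + 2·[m even]` and substitute `m = 2m'` in the even part, here `F`. -/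
lemma alternatingLambert_eq (k : ℕ) {q : ℂ} (hq : ‖q‖ < 1) :
    alternatingLambert k q = -lambert k q + 2 ^ (k + 1) * lambert k (q ^ 2) := by
  have hq₂ : ‖q ^ 2‖ < 1 := by
    rw [norm_pow]
    exact pow_lt_one₀ (norm_nonneg q) hq two_ne_zero
  let i : ℕ+ × ℕ+ → ℕ+ × ℕ+ := fun x ↦ (x.1, 2 * x.2)
  have hi : Function.Injective i := by
    rintro ⟨a, b⟩ ⟨c, d⟩ h
    simpa [i] using h
  let F : ℕ+ × ℕ+ → ℂ := fun x ↦
    if Even (x.2 : ℕ) then 2 * ((x.2 : ℂ) ^ k * q ^ (x.1 * x.2 : ℕ)) else 0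
  have hF : HasSum F (2 ^ (k + 1) * lambert k (q ^ 2)) := by
    rw [← hi.hasSum_iff]
    · convert! (summable_prod_mul_pow k hq₂).hasSum.mul_left (2 ^ (k + 1)) using 1
      ext x
      simp only [Function.comp_apply, F, i, PNat.mul_coe, PNat.val_ofNat, even_two,
        Even.mul_right, if_true, ← pow_mul]
      push_cast
      ring_nf
    · rintro ⟨a, b⟩ hx
      refine if_neg fun hb ↦ hx ?_
      obtain ⟨c, hc⟩ := even_iff_two_dvd.mp hb
      have hc₀ : 0 < c := by
        have := b.pos
        simp only at hc
        omega
      exact ⟨(a, ⟨c, hc₀⟩), Prod.ext rfl (PNat.eq hc.symm)⟩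
  refine HasSum.tsum_eq ?_
  convert! (summable_prod_mul_pow k hq).hasSum.neg.add hF using 1
  ext x
  by_cases hx : Even (x.2 : ℕ)
  · simp only [F, hx, hx.neg_one_pow, if_true]
    ring
  · simp only [F, hx, (Nat.not_even_iff_odd.mp hx).neg_one_pow, if_false]
    ring

lemma norm_pow_pnat_lt_one {q : ℂ} (hq : ‖q‖ < 1) (n : ℕ+) : ‖q ^ (n : ℕ)‖ < 1 := by
  rw [norm_pow]
  exact pow_lt_one₀ (norm_nonneg q) hq n.ne_zero

lemma tsum_pow_eq_sum_alternatingLambert (l : ℕ) : ∃ c : ℕ → ℂ, ∀ q : ℂ, ‖q‖ < 1 →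
    ∑' n : ℕ+, (q ^ (n : ℕ) / (1 + 2 * q ^ (n : ℕ) + q ^ (2 * (n : ℕ)))) ^ (l + 1) =
      ∑ j ∈ Finset.range (l + 1), c j * alternatingLambert (2 * j + 1) q := by
  obtain ⟨c, hc⟩ := choose_eq_sum_odd_pow l
  refine ⟨fun j ↦ (-1) ^ (l + 1) * c j, fun q hq ↦ ?_⟩
  have hs (j : ℕ) := (summable_alternatingLambert (2 * j + 1) hq).mul_left (c j)
  calc _ = ∑' n : ℕ+, (-1) ^ (l + 1) * ∑' m : ℕ+, ∑ j ∈ Finset.range (l + 1),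
        c j * ((-1) ^ (m : ℕ) * ((m : ℂ) ^ (2 * j + 1) * q ^ (n * m : ℕ))) := by
        refine tsum_congr fun n ↦ ?_
        have h := tsum_pnat_choose_mul_neg_pow l (norm_pow_pnat_lt_one hq n)
        rw [mul_comm 2 (n : ℕ), pow_mul q]
        rw [← mul_right_inj' (pow_ne_zero (l + 1) (neg_ne_zero.mpr (one_ne_zero (α := ℂ)))), ← h,
          ← mul_assoc, ← pow_add, Even.neg_one_pow ⟨l + 1, rfl⟩, one_mul]
        refine tsum_congr fun m ↦ ?_
        rw [hc, Finset.sum_mul]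
        refine Finset.sum_congr rfl fun j _ ↦ ?_
        rw [neg_pow, ← pow_mul]
        ring
    _ = (-1) ^ (l + 1) * ∑' x : ℕ+ × ℕ+, ∑ j ∈ Finset.range (l + 1),
        c j * ((-1) ^ (x.2 : ℕ) * ((x.2 : ℂ) ^ (2 * j + 1) * q ^ (x.1 * x.2 : ℕ))) := by
        rw [tsum_mul_left, (summable_sum fun j _ ↦ hs j).tsum_prod]
    _ = _ := by
        rw [Summable.tsum_finsetSum fun j _ ↦ hs j, Finset.mul_sum]
        refine Finset.sum_congr rfl fun j _ ↦ ?_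
        rw [tsum_mul_left, mul_assoc, alternatingLambert]

lemma one_add_two_mul_add_sq_ne_zero {z : ℂ} (hz : ‖z‖ < 1) : 1 + 2 * z + z ^ 2 ≠ 0 := by
  rw [show 1 + 2 * z + z ^ 2 = (1 + z) ^ 2 by ring]
  refine pow_ne_zero 2 fun h ↦ ?_
  rw [← neg_eq_of_add_eq_zero_right h] at hz
  simp at hz

lemma summable_norm_pow_div {q : ℂ} (hq : ‖q‖ < 1) : Summable fun n : ℕ+ ↦
    ‖q ^ (n : ℕ) / (1 + 2 * q ^ (n : ℕ) + q ^ (2 * (n : ℕ)))‖ := by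
  have hg : Summable fun n : ℕ+ ↦ ‖q ^ (n : ℕ)‖ * ((1 - ‖q‖) ^ 2)⁻¹ :=
    ((summable_norm_geometric_of_norm_lt_one hq).comp_injective PNat.coe_injective).mul_right _
  refine hg.of_nonneg_of_le (fun _ ↦ norm_nonneg _) fun n ↦ ?_
  rw [norm_div, div_eq_mul_inv, mul_comm 2 (n : ℕ), pow_mul,
    show 1 + 2 * q ^ (n : ℕ) + (q ^ (n : ℕ)) ^ 2 = (1 + q ^ (n : ℕ)) ^ 2 by ring, norm_pow (1 + _)]
  have h₀ : 0 < 1 - ‖q‖ := sub_pos.mpr hq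
  have h₁ : 1 - ‖q‖ ≤ ‖1 + q ^ (n : ℕ)‖ := by
    have h₂ : ‖q ^ (n : ℕ)‖ ≤ ‖q‖ := by
      rw [norm_pow]
      exact pow_le_of_le_one (norm_nonneg q) hq.le n.ne_zero
    have h₃ := norm_sub_norm_le (1 : ℂ) (-q ^ (n : ℕ))
    rw [norm_one, norm_neg, sub_neg_eq_add] at h₃
    linarith
  gcongr

end Lambert
end

noncomputable section

/-! ### Eisenstein series, power sums and the induction on `t`. -/

section MacMahon

open UpperHalfPlane EisensteinSeries
open scoped ArithmeticFunction.sigma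

lemma lambert_eq_tsum_sigma (k : ℕ) {q : ℂ} (hq : ‖q‖ < 1) :
    lambert k q = ∑' n : ℕ+, (σ k n : ℂ) * q ^ (n : ℕ) := by
  rw [lambert, (summable_prod_mul_pow k hq).tsum_prod, tsum_prod_pow_eq_tsum_sigma k hq]

/-- Solve the `q`-expansion `E = 1 + c ∑ σ(n) q^n` for the sum. Weight 2 is separate because `E2` is
not modular. -/
lemma exists_lambert_eq (j : ℕ) : ∃ a b : ℂ, ∃ E ∈ quasimodularForms ⊤ ((2 * j + 2 : ℕ) : ℤ),
    ∀ τ : ℍ, lambert (2 * j + 1) (Complex.exp (2 * Real.pi * Complex.I * τ)) = a + b * E τ := by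
  rcases Nat.eq_zero_or_pos j with rfl | hj
  · refine ⟨1 / 24, -1 / 24, E2, E2_mem_quasimodularForms, fun τ ↦ ?_⟩
    rw [lambert_eq_tsum_sigma _ (norm_exp_two_pi_I_lt_one τ), E2_eq_tsum_cexp]
    ring
  · have hk : 3 ≤ 2 * j + 2 := by omega
    have heven : Even (2 * j + 2) := ⟨j + 1, by ring⟩
    set c : ℂ := (riemannZeta ((2 * j + 2 : ℕ) : ℂ))⁻¹ *
      (-2 * Real.pi * Complex.I) ^ (2 * j + 2) / ((2 * j + 2 - 1).factorial : ℂ) with hc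
    have hc₀ : c ≠ 0 := by
      have hζ : riemannZeta ((2 * j + 2 : ℕ) : ℂ) ≠ 0 := by
        refine riemannZeta_ne_zero_of_one_lt_re ?_
        rw [Complex.natCast_re]
        exact_mod_cast (by omega : 1 < 2 * j + 2)
      have hπ : (-2 * Real.pi * Complex.I : ℂ) ≠ 0 := by simp [Real.pi_ne_zero]
      exact div_ne_zero (mul_ne_zero (inv_ne_zero hζ) (pow_ne_zero _ hπ))
        (by exact_mod_cast Nat.factorial_ne_zero _)
    refine ⟨-c⁻¹, c⁻¹, ModularForm.E hk, ModularForm.mem_quasimodularForms _, fun τ ↦ ?_⟩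
    rw [lambert_eq_tsum_sigma _ (norm_exp_two_pi_I_lt_one τ), q_expansion_riemannZeta hk heven,
      ← hc]
    simp only [zpow_natCast, show 2 * j + 2 - 1 = 2 * j + 1 by omega]
    field_simp
    ring

lemma alternatingLambert_mem (j : ℕ) :
    (fun τ : ℍ ↦ alternatingLambert (2 * j + 1) (Complex.exp (2 * Real.pi * Complex.I * τ))) ∈
      quasimodularFormsMixed (CongruenceSubgroup.Gamma0 2) (2 * j + 2) := by
  obtain ⟨a, b, E, hE, h⟩ := exists_lambert_eq j
  have h₁ := quasimodularForms_le_mixed le_rfl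
    (quasimodularForms_antitone (le_top (a := CongruenceSubgroup.Gamma0 2)) _ hE)
  have h₂ := quasimodularForms_le_mixed le_rfl (scale_mem_quasimodularForms 2 hE)
  have h₀ := one_mem_quasimodularFormsMixed (Γ := CongruenceSubgroup.Gamma0 2) (2 * j + 2)
  convert! add_mem (add_mem (Submodule.smul_mem _ ((2 ^ (2 * j + 2) - 1) * a) h₀)
    (Submodule.smul_mem _ (-b) h₁)) (Submodule.smul_mem _ (2 ^ (2 * j + 2) * b) h₂) using 1
  ext τ
  have hq : Complex.exp (2 * Real.pi * Complex.I * τ) ^ 2 =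
      Complex.exp (2 * Real.pi * Complex.I * (scaleMatrix 2 • τ : ℍ)) := by
    rw [coe_scaleMatrix_smul, ← Complex.exp_nat_mul]
    congr 1
    push_cast
    ring
  rw [alternatingLambert_eq _ (norm_exp_two_pi_I_lt_one τ), hq, h, h]
  simp only [Pi.add_apply, Pi.smul_apply, Pi.one_apply, smul_eq_mul]
  ring

lemma tsum_pow_mem (l : ℕ) :
    (fun τ : ℍ ↦ ∑' n : ℕ+, (Complex.exp (2 * Real.pi * Complex.I * τ) ^ (n : ℕ) /
      (1 + 2 * Complex.exp (2 * Real.pi * Complex.I * τ) ^ (n : ℕ) +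
        Complex.exp (2 * Real.pi * Complex.I * τ) ^ (2 * (n : ℕ)))) ^ (l + 1)) ∈
      quasimodularFormsMixed (CongruenceSubgroup.Gamma0 2) (2 * (l + 1)) := by
  obtain ⟨c, hc⟩ := tsum_pow_eq_sum_alternatingLambert l
  simp_rw [hc _ (norm_exp_two_pi_I_lt_one _)]
  rw [← Finset.sum_fn]
  refine sum_mem fun j hj ↦ ?_
  rw [Finset.mem_range] at hj
  exact Submodule.smul_mem _ (c j)
    (quasimodularFormsMixed_mono (by omega) (alternatingLambert_mem j))

lemma macMahonU_zero (a q : ℂ) : macMahonU 0 a q = 1 := by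
  rw [macMahonU, tsum_eq_single ⟨∅, rfl⟩]
  · simp [macMahonTerm]
  · rintro ⟨s, hs⟩ h
    exact absurd (Subtype.ext (Finset.card_eq_zero.mp hs)) h

lemma macMahonU_two_mem (t : ℕ) :
    (fun τ : ℍ ↦ macMahonU t 2 (Complex.exp (2 * Real.pi * Complex.I * τ))) ∈
      quasimodularFormsMixed (CongruenceSubgroup.Gamma0 2) (2 * t) := by
  induction t using Nat.strong_induction_on with
  | _ t ih =>
  rcases Nat.eq_zero_or_pos t with rfl | ht
  · simp_rw [macMahonU_zero]
    exact one_mem_quasimodularFormsMixed _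
  have ht₀ : (t : ℂ) ≠ 0 := by exact_mod_cast ht.ne'
  have hN (τ : ℍ) := mul_tsum_prod_eq_sum
    (summable_norm_pow_div (norm_exp_two_pi_I_lt_one τ)) t
  convert! Submodule.smul_mem _ ((t : ℂ)⁻¹ * (-1) ^ (t + 1)) (sum_mem (t :=
    (Finset.HasAntidiagonal.antidiagonal t).filter fun a ↦ a.1 < t) (f := fun a ↦
      ((-1 : ℂ) ^ a.1) • ((fun τ : ℍ ↦ macMahonU a.1 2
        (Complex.exp (2 * Real.pi * Complex.I * τ))) * fun τ : ℍ ↦ ∑' n : ℕ+,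
        (Complex.exp (2 * Real.pi * Complex.I * τ) ^ (n : ℕ) /
        (1 + 2 * Complex.exp (2 * Real.pi * Complex.I * τ) ^ (n : ℕ) +
        Complex.exp (2 * Real.pi * Complex.I * τ) ^ (2 * (n : ℕ)))) ^ a.2))
      fun a ha ↦ Submodule.smul_mem _ _ ?_) using 1
  · ext τ
    simp only [Pi.smul_apply, Finset.sum_apply, Pi.mul_apply, smul_eq_mul]
    rw [mul_assoc (t : ℂ)⁻¹, eq_inv_mul_iff_mul_eq₀ ht₀]
    refine (hN τ).trans ?_
    congr 1
    exact Finset.sum_congr rfl fun a _ ↦ mul_assoc _ _ _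
  · simp only [Finset.mem_filter, Finset.HasAntidiagonal.mem_antidiagonal] at ha
    obtain ⟨l, hl⟩ : ∃ l, a.2 = l + 1 := ⟨a.2 - 1, by omega⟩
    -- The weight bounds of the two Newton factors add up to exactly `2t`.
    have hw : 2 * t = 2 * a.1 + 2 * (l + 1) := by omega
    rw [hw, hl]
    exact quasimodularFormsMixed_mul_mem (ih a.1 ha.2) (tsum_pow_mem l)

end MacMahon

end

theorem mainTheorem7 (t : ℕ) :
    (∀ q : ℂ, ‖q‖ < 1 →
      (∀ n : ℕ+, 1 + 2 * q ^ (n : ℕ) + q ^ (2 * (n : ℕ)) ≠ 0) ∧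
      Summable (fun s : {s : Finset ℕ+ // s.card = t} ↦ macMahonTerm 2 q s)) ∧
    (fun τ : UpperHalfPlane ↦ macMahonU t 2 (Complex.exp (2 * Real.pi * Complex.I * (τ : ℂ)))) ∈
      quasimodularFormsMixed (CongruenceSubgroup.Gamma0 2) (2 * t) := by
  refine ⟨fun q hq ↦ ⟨fun n ↦ ?_, ?_⟩, macMahonU_two_mem t⟩
  · rw [mul_comm 2 (n : ℕ), pow_mul]
    exact one_add_two_mul_add_sq_ne_zero (norm_pow_pnat_lt_one hq n)
  · exact (summable_finsetProd_of_summable_norm (summable_norm_pow_div hq)).subtype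
      {s | s.card = t}
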